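/- Let $L$ be a non-empty locally compact Hausdorff space, let $\mathbb{K}$ be $\mathbb{R}$ or $\mathbb{C}$, and let $C_0(L)$ be the Banach space of continuous functions $L\to\mathbb{K}$ vanishing at infinity, with the supremum norm. Let $f_1,\ldots,f_\ell\in C_0(L)$ with $\|f_j\|\le 1$ for $j=1,\ldots,\ell$, let $\mu_1,\ldots,\mu_n\in C_0(L)^*$ with $\|\mu_j\|\le 1$ for $j=1,\ldots,n$, and let $\varepsilon>0$. Then there exists a bounded linear projection $P\colon C_0(L)\to C_0(L)$ (that is, $P^2=P$) with $\|P\|=1$ such that 1. $\|P^*(\mu_j)-\mu_j\|<\varepsilon$ for $j=1,\ldots,n$, where $P^*$ is the adjoint of $P$, i.e. $P^*(\mu)=\mu\circ P$; 2. $\|P(f_j)-f_j\|<\varepsilon$ for $j=1,\ldots,\ell$; 3. $P(C_0(L))$ is isometrically isomorphic to $\ell_\infty^p$, i.e. $\mathbb{K}^p$ with the maximum norm, for some integer $p\ge 1$. -/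

import Mathlib

open scoped ZeroAtInfty

/-!
A bounded functional on `C₀(L, 𝕜)` is dominated by its total variation, a positive functional on
`C_c(L, ℝ≥0)`, which the Riesz–Markov–Kakutani theorem represents by a finite measure
(`exists_measure_norm_le`). Let `ν` dominate all the `μ j` in this way. Then `μ j` is, up to a small
error in norm, integration against `g j • ν` for a *continuous* density `g j ∈ C₀(L, 𝕜)`
(`exists_density`). This replaces the Radon–Nikodym theorem and the approximation of densities in
`L¹(ν)`: the density is a near-minimizer of a quadratic functional.

Now all the data are continuous functions: the `f j` and `g j` combine to a map `F` from `L` to a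
finite-dimensional space, vanishing at infinity. Cover the range of `F` by finitely many small balls,
the first one centered at `0`. Ordered products of cut-offs of these balls give a partition of unity
on `L`, subordinate to sets on which `F` is nearly constant, whose members are `0` or `1` off finitely
many thin open shells. The shells shrink to the empty set, so they can be given small `ν`-measure.
Passing to a minimal subcover and normalizing makes each member attain the value `1`, and dropping the
member around `F = 0` leaves functions `χ k` vanishing at infinity (`exists_bumps`).

The projection is `P f = ∑ k, (average of f over {χ k = 1}) • χ k`, with averages in the sense of `ν`,
or of a point mass if `{χ k = 1}` is a null set. Since `χ i = 0` where `χ k = 1` for `i ≠ k`, the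
`χ k` span an isometric copy of `ℓ_∞^p` and the averages invert this embedding contractively. As
`F` is nearly constant on the support of each `χ k`, `P (f j)` is close to `f j`
(`IsBumpFamily.norm_projection_sub_le`). As `P h - h` has `ν`-integral zero over each `{χ k = 1}`,
where `g j` is nearly constant, and the rest of `L` contributes little, `∫ g j * (P h - h) ∂ν` is
small uniformly for `‖h‖ ≤ 1` (`IsBumpFamily.norm_integral_mul_projection_sub_le`).
-/

open MeasureTheory Filter Topology
open scoped NNReal ENNReal CompactlySupported

/-! ### Evaluation and multiplication in `C₀(L, 𝕜)` -/

namespace ZeroAtInftyContinuousMap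

section Norm

variable {𝕜 : Type*} [RCLike 𝕜] {L : Type*} [TopologicalSpace L]

lemma norm_apply_le (f : C₀(L, 𝕜)) (x : L) : ‖f x‖ ≤ ‖f‖ := by
  rw [← norm_toBCF_eq_norm]
  exact f.toBCF.norm_coe_le_norm x

lemma norm_le_of_forall {f : C₀(L, 𝕜)} {C : ℝ} (hC : 0 ≤ C) (h : ∀ x, ‖f x‖ ≤ C) : ‖f‖ ≤ C := by
  rw [← norm_toBCF_eq_norm]
  exact (BoundedContinuousFunction.norm_le hC).2 h

lemma exists_eq_mul (f : C₀(L, 𝕜)) {h : L → 𝕜} (hc : Continuous h) (h1 : ∀ x, ‖h x‖ ≤ 1) :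
    ∃ g : C₀(L, 𝕜), ∀ x, g x = h x * f x := by
  refine ⟨⟨⟨fun x => h x * f x, hc.mul f.continuous⟩, ?_⟩, fun x => rfl⟩
  refine squeeze_zero_norm (a := fun x => ‖f x‖) (fun x => ?_) ?_
  · simpa using mul_le_mul_of_nonneg_right (h1 x) (norm_nonneg (f x))
  · simpa using (zero_at_infty f).norm

variable [MeasurableSpace L] [BorelSpace L]

lemma integrable_mul (ν : Measure L) [IsFiniteMeasure ν] (f g : C₀(L, 𝕜)) :
    Integrable (fun x => g x * f x) ν := by
  refine Integrable.of_bound (C := ‖g‖ * ‖f‖) ?_ ?_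
  · exact (g.continuous.mul f.continuous).aestronglyMeasurable
  · refine Eventually.of_forall fun x => ?_
    rw [norm_mul]
    exact mul_le_mul (norm_apply_le _ _) (norm_apply_le _ _) (norm_nonneg _) (norm_nonneg _)

lemma integrable (ν : Measure L) [IsFiniteMeasure ν] (f : C₀(L, 𝕜)) : Integrable f ν :=
  Integrable.of_bound (C := ‖f‖) f.continuous.aestronglyMeasurable
    (Eventually.of_forall fun x => norm_apply_le f x)

end Norm

/-! ### The total variation of a functional -/

section TotalVariation

variable {𝕜 : Type*} [RCLike 𝕜] {L : Type*} [TopologicalSpace L]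

/-- The total variation of the functional `φ`, evaluated at a nonnegative function `u`: the supremum
of `‖φ g‖` over all `g` with `|g| ≤ u`. -/
noncomputable def totalVariation (φ : StrongDual 𝕜 C₀(L, 𝕜)) (u : L → ℝ≥0) : ℝ :=
  sSup {r | ∃ g : C₀(L, 𝕜), (∀ x, ‖g x‖ ≤ u x) ∧ r = ‖φ g‖}

variable (φ : StrongDual 𝕜 C₀(L, 𝕜)) {u v : L → ℝ≥0}

lemma totalVariation_nonneg : 0 ≤ totalVariation φ u := by
  refine Real.sSup_nonneg ?_
  rintro _ ⟨g, -, rfl⟩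
  positivity

lemma totalVariation_le {C : ℝ} (h : ∀ g : C₀(L, 𝕜), (∀ x, ‖g x‖ ≤ u x) → ‖φ g‖ ≤ C) :
    totalVariation φ u ≤ C := by
  refine csSup_le ⟨_, 0, by simp, rfl⟩ ?_
  rintro _ ⟨g, hg, rfl⟩
  exact h g hg

lemma le_totalVariation {B : ℝ≥0} (hB : ∀ x, u x ≤ B) {g : C₀(L, 𝕜)} (hg : ∀ x, ‖g x‖ ≤ u x) :
    ‖φ g‖ ≤ totalVariation φ u := by
  refine le_csSup ⟨‖φ‖ * B, ?_⟩ ⟨g, hg, rfl⟩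
  rintro _ ⟨g, hg, rfl⟩
  refine φ.le_opNorm_of_le (norm_le_of_forall B.2 fun x => (hg x).trans ?_)
  exact_mod_cast hB x

lemma add_totalVariation_le {B : ℝ≥0} (hB : ∀ x, u x + v x ≤ B) :
    totalVariation φ u + totalVariation φ v ≤ totalVariation φ (u + v) := by
  rw [← le_sub_iff_add_le]
  refine totalVariation_le φ fun g hg => ?_
  rw [le_sub_comm]
  refine totalVariation_le φ fun h hh => ?_
  rw [le_sub_iff_add_le']
  obtain ⟨c, hc, hcg⟩ := RCLike.exists_norm_eq_mul_self (φ g)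
  obtain ⟨d, hd, hdh⟩ := RCLike.exists_norm_eq_mul_self (φ h)
  have key : φ (c • g + d • h) = ((‖φ g‖ + ‖φ h‖ : ℝ) : 𝕜) := by
    rw [map_add, map_smul, map_smul, smul_eq_mul, smul_eq_mul, ← hcg, ← hdh]
    push_cast; rfl
  have := le_totalVariation φ (u := u + v) hB (g := c • g + d • h) (fun x => by
    have h1 : ‖c * g x‖ ≤ u x := by simpa [hc] using hg x
    have h2 : ‖d * h x‖ ≤ v x := by simpa [hd] using hh x
    simpa using (norm_add_le _ _).trans (add_le_add h1 h2))
  rwa [key, RCLike.norm_ofReal, abs_of_nonneg (by positivity)] at this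

/-- Subadditivity, by splitting `g` with `|g| ≤ u + v` in the ratio `u : v`. The denominator
`u + v + δ` keeps the pieces continuous at the common zeros of `u` and `v`, at the price of a
remainder of norm at most `δ`. -/
lemma totalVariation_add_le {B : ℝ≥0} (hB : ∀ x, u x + v x ≤ B) (hu : Continuous u)
    (hv : Continuous v) :
    totalVariation φ (u + v) ≤ totalVariation φ u + totalVariation φ v := by
  refine totalVariation_le φ fun g hg => ?_
  refine le_of_forall_pos_le_add fun ε hε => ?_
  obtain ⟨δ, hδ, hδε⟩ : ∃ δ : ℝ, 0 < δ ∧ ‖φ‖ * δ ≤ ε := by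
    refine ⟨ε / (‖φ‖ + 1), by positivity, ?_⟩
    rw [mul_div_assoc', div_le_iff₀ (by positivity)]
    nlinarith [norm_nonneg φ]
  have hpos : ∀ x, 0 < (u x + v x + δ : ℝ) := fun x => by positivity
  have hne : ∀ x, (((u x : ℝ) + v x + δ : ℝ) : 𝕜) ≠ 0 := fun x => by
    exact_mod_cast (hpos x).ne'
  have split : ∀ w : L → ℝ, Continuous w → (∀ x, 0 ≤ w x) → (∀ x, w x ≤ u x + v x + δ) →
      ∃ g' : C₀(L, 𝕜), ∀ x, g' x = ((w x / (u x + v x + δ) : ℝ) : 𝕜) * g x := by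
    intro w hw h0 h1
    refine exists_eq_mul g (h := fun x => ((w x / (u x + v x + δ) : ℝ) : 𝕜)) ?_ fun x => ?_
    · refine RCLike.continuous_ofReal.comp (hw.div (by fun_prop) fun x => (hpos x).ne')
    · rw [RCLike.norm_ofReal, abs_of_nonneg (div_nonneg (h0 x) (hpos x).le)]
      exact (div_le_one (hpos x)).2 (h1 x)
  have bound : ∀ (w : L → ℝ) (x : L), 0 ≤ w x →
      ‖((w x / (u x + v x + δ) : ℝ) : 𝕜) * g x‖ ≤ w x := by
    intro w x h0
    rw [norm_mul, RCLike.norm_ofReal, abs_of_nonneg (div_nonneg h0 (hpos x).le), div_mul_eq_mul_div,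
      div_le_iff₀ (hpos x)]
    refine mul_le_mul_of_nonneg_left ?_ h0
    have := hg x
    simp only [Pi.add_apply, NNReal.coe_add] at this
    linarith
  obtain ⟨g₁, h₁⟩ := split (fun x => u x) (by fun_prop) (fun x => (u x).2)
    (fun x => by linarith [(v x).2])
  obtain ⟨g₂, h₂⟩ := split (fun x => v x) (by fun_prop) (fun x => (v x).2)
    (fun x => by linarith [(u x).2])
  obtain ⟨g₃, h₃⟩ := split (fun _ => δ) continuous_const (fun x => hδ.le)
    (fun x => by linarith [(u x).2, (v x).2])
  have hsum : g = g₁ + g₂ + g₃ := by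
    ext x
    simp only [add_apply, h₁, h₂, h₃]
    rw [← add_mul, ← add_mul, ← RCLike.ofReal_add, ← RCLike.ofReal_add, ← add_div, ← add_div,
      div_self (hpos x).ne']
    simp
  have e₁ : ‖φ g₁‖ ≤ totalVariation φ u :=
    le_totalVariation φ (B := B) (fun x => le_self_add.trans (hB x)) fun x => by
      rw [h₁]; exact bound (fun x => u x) x (u x).2
  have e₂ : ‖φ g₂‖ ≤ totalVariation φ v :=
    le_totalVariation φ (B := B) (fun x => le_add_self.trans (hB x)) fun x => by
      rw [h₂]; exact bound (fun x => v x) x (v x).2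
  have e₃ : ‖φ g₃‖ ≤ ε := (φ.le_opNorm_of_le (norm_le_of_forall hδ.le fun x => by
      rw [h₃]; exact bound (fun _ => δ) x hδ.le)).trans hδε
  rw [hsum, map_add, map_add]
  exact (norm_add₃_le).trans (by linarith)

lemma smul_totalVariation_le {B : ℝ≥0} (hB : ∀ x, u x ≤ B) (c : ℝ≥0) :
    c * totalVariation φ u ≤ totalVariation φ (c • u) := by
  rcases eq_or_ne c 0 with rfl | hc
  · simpa using totalVariation_nonneg φ
  have hc' : (0 : ℝ) < c := by exact_mod_cast pos_iff_ne_zero.2 hc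
  rw [mul_comm, ← le_div_iff₀ hc']
  refine totalVariation_le φ fun g hg => ?_
  rw [le_div_iff₀ hc']
  have := le_totalVariation φ (u := c • u) (B := c * B) (g := ((c : ℝ) : 𝕜) • g)
    (fun x => mul_le_mul_right (hB x) c) (fun x => by
      simpa using mul_le_mul_of_nonneg_left (hg x) hc'.le)
  rwa [map_smul, norm_smul, RCLike.norm_ofReal, abs_of_nonneg hc'.le, mul_comm] at this

lemma totalVariation_smul {B : ℝ≥0} (hB : ∀ x, u x ≤ B) (c : ℝ≥0) :
    totalVariation φ (c • u) = c * totalVariation φ u := by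
  refine le_antisymm ?_ (smul_totalVariation_le φ hB c)
  rcases eq_or_ne c 0 with rfl | hc
  · refine totalVariation_le φ fun g hg => ?_
    have : g = 0 := by ext x; simpa using hg x
    simp [this]
  have := smul_totalVariation_le φ (u := c • u) (B := c * B)
    (fun x => mul_le_mul_right (hB x) c) c⁻¹
  rw [inv_smul_smul₀ hc, NNReal.coe_inv] at this
  rwa [inv_mul_le_iff₀ (by exact_mod_cast pos_iff_ne_zero.2 hc)] at this

lemma _root_.CompactlySupportedContinuousMap.exists_forall_le (u : C_c(L, ℝ≥0)) :
    ∃ B : ℝ≥0, ∀ x, u x ≤ B := by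
  have hc : HasCompactSupport fun x => (u x : ℝ) :=
    u.hasCompactSupport.comp_left (g := fun r : ℝ≥0 => (r : ℝ)) rfl
  obtain ⟨C, hC⟩ := hc.exists_bound_of_continuous (by fun_prop)
  exact ⟨C.toNNReal, fun x => NNReal.coe_le_coe.1 <|
    (le_abs_self _).trans <| (hC x).trans (Real.le_coe_toNNReal C)⟩

/-- The total variation of `φ` as a positive linear functional on `C_c(L, ℝ≥0)`. -/
noncomputable def totalVariationLinearMap : C_c(L, ℝ≥0) →ₗ[ℝ≥0] ℝ≥0 where
  toFun u := (totalVariation φ u).toNNReal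
  map_add' u v := by
    obtain ⟨B, hB⟩ := (u + v).exists_forall_le
    have hB' : ∀ x, u x + v x ≤ B := fun x => by simpa using hB x
    refine NNReal.eq ?_
    rw [NNReal.coe_add, Real.coe_toNNReal _ (totalVariation_nonneg φ),
      Real.coe_toNNReal _ (totalVariation_nonneg φ), Real.coe_toNNReal _ (totalVariation_nonneg φ),
      CompactlySupportedContinuousMap.coe_add]
    exact le_antisymm (totalVariation_add_le φ hB' u.continuous v.continuous)
      (add_totalVariation_le φ hB')
  map_smul' c u := by
    obtain ⟨B, hB⟩ := u.exists_forall_le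
    refine NNReal.eq ?_
    rw [RingHom.id_apply, smul_eq_mul, NNReal.coe_mul,
      Real.coe_toNNReal _ (totalVariation_nonneg φ), Real.coe_toNNReal _ (totalVariation_nonneg φ),
      CompactlySupportedContinuousMap.coe_smul]
    exact totalVariation_smul φ hB c

lemma coe_totalVariationLinearMap (u : C_c(L, ℝ≥0)) :
    (totalVariationLinearMap φ u : ℝ) = totalVariation φ u :=
  Real.coe_toNNReal _ (totalVariation_nonneg φ)

variable [T2Space L] [LocallyCompactSpace L] [MeasurableSpace L] [BorelSpace L]

/-- Every bounded functional on `C₀(L, 𝕜)` is dominated by the `L¹`-seminorm of a finite measure,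
the one representing its total variation. -/
theorem exists_measure_norm_le :
    ∃ ν : Measure L, IsFiniteMeasure ν ∧ ∀ f : C₀(L, 𝕜), ‖φ f‖ ≤ ∫ x, ‖f x‖ ∂ν := by
  set Λ := totalVariationLinearMap φ
  set ν := NNRealRMK.rieszMeasure Λ with hν
  have bump : ∀ K : Set L, IsCompact K → ∃ w : C_c(L, ℝ≥0), (∀ x, w x ≤ 1) ∧ ∀ x ∈ K, w x = 1 := by
    intro K hK
    obtain ⟨w, hw1, -, hwc, hw⟩ := exists_continuous_one_zero_of_isCompact hK isClosed_empty
      (Set.disjoint_empty K)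
    refine ⟨⟨⟨fun x => (w x).toNNReal, by fun_prop⟩, hwc.comp_left (g := Real.toNNReal) (by simp)⟩,
      fun x => ?_,
      fun x hx => ?_⟩
    · exact Real.toNNReal_le_one.2 (hw x).2
    · change (w x).toNNReal = 1
      simp [hw1 hx]
  have hfin : ν Set.univ ≤ ENNReal.ofReal ‖φ‖ := by
    rw [isOpen_univ.measure_eq_iSup_isCompact]
    refine iSup₂_le fun K _ => iSup_le fun hK => ?_
    obtain ⟨w, hw, hwK⟩ := bump K hK
    calc ν K = ∫⁻ x in K, w x ∂ν := by
          rw [setLIntegral_congr_fun (g := fun _ => 1) hK.measurableSet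
            (fun x hx => by simp [hwK x hx])]
          simp
      _ ≤ ∫⁻ x, w x ∂ν := setLIntegral_le_lintegral _ _
      _ = Λ w := NNRealRMK.lintegral_rieszMeasure Λ w
      _ ≤ ENNReal.ofReal ‖φ‖ := by
          rw [← ENNReal.ofReal_coe_nnreal]
          rw [coe_totalVariationLinearMap]
          refine ENNReal.ofReal_le_ofReal (totalVariation_le φ fun g hg => ?_)
          simpa using φ.le_opNorm_of_le (norm_le_of_forall zero_le_one fun x =>
            (hg x).trans (by exact_mod_cast hw x))
  have : IsFiniteMeasure ν := ⟨hfin.trans_lt ENNReal.ofReal_lt_top⟩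
  refine ⟨ν, inferInstance, fun f => le_of_forall_pos_le_add fun ε hε => ?_⟩
  obtain ⟨δ, hδ, hδε⟩ : ∃ δ : ℝ, 0 < δ ∧ ‖φ‖ * δ ≤ ε := by
    refine ⟨ε / (‖φ‖ + 1), by positivity, ?_⟩
    rw [mul_div_assoc', div_le_iff₀ (by positivity)]
    nlinarith [norm_nonneg φ]
  -- A cut-off brings `f` into the compactly supported functions, which `Λ` knows about.
  have hmem : {x | ‖f x‖ < δ} ∈ cocompact L := by
    have := (zero_at_infty f).norm
    rw [norm_zero] at this
    exact this.eventually (gt_mem_nhds hδ)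
  obtain ⟨K, hK, hKδ⟩ := mem_cocompact.1 hmem
  obtain ⟨w, hw, hwK⟩ := bump K hK
  obtain ⟨g, hg⟩ := exists_eq_mul f (h := fun x => ((w x : ℝ) : 𝕜))
    (RCLike.continuous_ofReal.comp (by fun_prop)) (fun x => by simpa using hw x)
  have hgf : ‖f - g‖ ≤ δ := by
    refine norm_le_of_forall hδ.le fun x => ?_
    by_cases hx : x ∈ K
    · simp [hg, hwK x hx, hδ.le]
    · have e : (f - g) x = ((1 - w x : ℝ) : 𝕜) * f x := by
        simp [hg]; ring
      have h1 : (w x : ℝ) ≤ 1 := by exact_mod_cast hw x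
      rw [e, norm_mul, RCLike.norm_ofReal, abs_of_nonneg (by linarith)]
      have h2 : ‖f x‖ < δ := hKδ hx
      nlinarith [norm_nonneg (f x), (w x).2]
  let u : C_c(L, ℝ≥0) := ⟨⟨fun x => w x * ‖f x‖₊, by fun_prop⟩, w.hasCompactSupport.mul_right⟩
  obtain ⟨B, hB⟩ := u.exists_forall_le
  have h1 : ‖φ g‖ ≤ ∫ x, ‖f x‖ ∂ν := by
    calc ‖φ g‖ ≤ Λ u := by
          rw [coe_totalVariationLinearMap]
          refine le_totalVariation φ hB fun x => ?_
          simp [hg, u]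
      _ = ∫ x, (u x : ℝ) ∂ν := (NNRealRMK.integral_rieszMeasure Λ u).symm
      _ ≤ ∫ x, ‖f x‖ ∂ν := by
          refine integral_mono_of_nonneg (Eventually.of_forall fun x => (u x).2)
            (integrable ν f).norm (Eventually.of_forall fun x => ?_)
          have : (w x : ℝ) ≤ 1 := by exact_mod_cast hw x
          simpa [u] using mul_le_mul_of_nonneg_right this (norm_nonneg (f x))
  have h2 : ‖φ (f - g)‖ ≤ ε := (φ.le_opNorm_of_le hgf).trans hδε
  calc ‖φ f‖ = ‖φ g + φ (f - g)‖ := by rw [← map_add]; simp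
    _ ≤ _ := (norm_add_le _ _).trans (add_le_add h1 h2)

/-- Finitely many bounded functionals on `C₀(L, 𝕜)` are dominated by a common finite measure. -/
theorem exists_measure_forall_norm_le {ι : Type*} [Fintype ι] (φ : ι → StrongDual 𝕜 C₀(L, 𝕜)) :
    ∃ ν : Measure L, IsFiniteMeasure ν ∧ ∀ j, ∀ f : C₀(L, 𝕜), ‖φ j f‖ ≤ ∫ x, ‖f x‖ ∂ν := by
  choose ν hν h using fun j => exists_measure_norm_le (φ j)
  refine ⟨∑ j, ν j, inferInstance, fun j f => (h j f).trans ?_⟩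
  refine integral_mono_measure ?_ (Eventually.of_forall fun x => norm_nonneg _) ?_
  · exact Finset.single_le_sum (f := ν) (fun i _ => Measure.zero_le _) (Finset.mem_univ j)
  · exact (integrable _ f).norm

end TotalVariation

/-! ### Continuous approximate densities -/

section Density

variable {𝕜 : Type*} [RCLike 𝕜] {L : Type*} [TopologicalSpace L] [MeasurableSpace L] [BorelSpace L]

/-- A functional dominated by the `L¹`-seminorm of a finite measure `ν` is within `δ` of integration
against a density in `C₀(L, 𝕜)`. The density is (the conjugate of) a near-minimizer of the quadratic
functional `g ↦ ‖g‖² - 2 Re φ(g)` for the norm of `L²(ν)`: a minimizer would represent `φ`. -/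
theorem exists_density (ν : Measure L) [IsFiniteMeasure ν] (φ : StrongDual 𝕜 C₀(L, 𝕜))
    (hφ : ∀ f : C₀(L, 𝕜), ‖φ f‖ ≤ ∫ x, ‖f x‖ ∂ν) {δ : ℝ} (hδ : 0 < δ) :
    ∃ g : C₀(L, 𝕜), ∀ f : C₀(L, 𝕜), ‖φ f - ∫ x, g x * f x ∂ν‖ ≤ δ * ‖f‖ := by
  set c := ν.real Set.univ with hc
  have hc0 : 0 ≤ c := measureReal_nonneg
  have hsq : ∀ f : C₀(L, 𝕜), Integrable (fun x => ‖f x‖ ^ 2) ν := fun f => by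
    simpa [sq] using (integrable_mul ν f f).norm
  let Q : C₀(L, 𝕜) → ℝ := fun g => (∫ x, ‖g x‖ ^ 2 ∂ν) - 2 * RCLike.re (φ g)
  -- Pointwise `2 |g| ≤ |g|² + 1`, so `Q` is bounded below by `-ν(L)`.
  have hQ : BddBelow (Set.range Q) := by
    refine ⟨-c, ?_⟩
    rintro _ ⟨g, rfl⟩
    have h1 : 2 * ∫ x, ‖g x‖ ∂ν ≤ (∫ x, ‖g x‖ ^ 2 ∂ν) + c := by
      have : c = ∫ _, (1 : ℝ) ∂ν := by simp [hc]
      rw [this, ← integral_add (hsq g) (integrable_const _), ← integral_const_mul]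
      refine integral_mono ((integrable ν g).norm.const_mul 2) ((hsq g).add (integrable_const _))
        fun x => ?_
      simp only
      nlinarith [sq_nonneg (‖g x‖ - 1)]
    have h2 := (RCLike.re_le_norm (φ g)).trans (hφ g)
    simp only [Q]
    linarith
  obtain ⟨η, hη, hηδ⟩ : ∃ η : ℝ, 0 < η ∧ η * (1 + c) ≤ 2 * δ := by
    refine ⟨2 * δ / (1 + c), by positivity, ?_⟩
    rw [div_mul_cancel₀ _ (by positivity)]
  obtain ⟨_, ⟨g, rfl⟩, hg⟩ := Real.lt_sInf_add_pos (Set.range_nonempty Q) (ε := η ^ 2)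
    (by positivity)
  have hmin : ∀ h, Q g ≤ Q h + η ^ 2 := fun h => by
    have := csInf_le hQ ⟨h, rfl⟩
    linarith
  have hint : ∀ f : C₀(L, 𝕜), Integrable (fun x => star g x * f x) ν :=
    fun f => integrable_mul ν f (star g)
  have hunit : ∀ f : C₀(L, 𝕜), ‖f‖ ≤ 1 → RCLike.re (φ f - ∫ x, star g x * f x ∂ν) ≤ δ := by
    intro f hf
    have hexp : Q (g + (η : 𝕜) • f) = Q g + η ^ 2 * (∫ x, ‖f x‖ ^ 2 ∂ν)
        - 2 * η * RCLike.re (φ f - ∫ x, star g x * f x ∂ν) := by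
      have e1 : ∀ x, ‖(g + (η : 𝕜) • f) x‖ ^ 2
          = ‖g x‖ ^ 2 + 2 * η * RCLike.re (star g x * f x) + η ^ 2 * ‖f x‖ ^ 2 := by
        intro x
        simp only [add_apply, smul_apply, smul_eq_mul, star_apply]
        have hre : RCLike.re (g x * (starRingEnd 𝕜) ((η : 𝕜) * f x))
            = η * RCLike.re (star (g x) * f x) := by
          rw [← RCLike.conj_re, map_mul, RCLike.conj_conj, mul_left_comm, RCLike.re_ofReal_mul,
            RCLike.star_def]
        rw [← RCLike.normSq_eq_def', ← RCLike.normSq_eq_def', ← RCLike.normSq_eq_def',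
          RCLike.normSq_add, hre, map_mul, RCLike.normSq_eq_def' (η : 𝕜), RCLike.norm_ofReal, sq_abs]
        ring
      have e2 : RCLike.re (φ (g + (η : 𝕜) • f)) = RCLike.re (φ g) + η * RCLike.re (φ f) := by
        rw [map_add, map_smul, smul_eq_mul, map_add, RCLike.re_ofReal_mul]
      simp only [Q]
      rw [integral_congr_ae (Eventually.of_forall e1), integral_add, integral_add (hsq g),
        integral_const_mul, integral_const_mul, e2, map_sub, integral_re (hint f)]
      · ring
      · exact (hint f).re.const_mul _
      · exact (hsq g).add ((hint f).re.const_mul _)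
      · exact (hsq f).const_mul _
    have hfc : ∫ x, ‖f x‖ ^ 2 ∂ν ≤ c := by
      calc ∫ x, ‖f x‖ ^ 2 ∂ν ≤ ∫ _, (1 : ℝ) ∂ν := by
            refine integral_mono (hsq f) (integrable_const _) fun x => ?_
            exact pow_le_one₀ (norm_nonneg _) ((norm_apply_le f x).trans hf)
        _ = c := by simp [hc]
    have h := hmin (g + (η : 𝕜) • f)
    rw [hexp] at h
    have h3 : 2 * RCLike.re (φ f - ∫ x, star g x * f x ∂ν) ≤ η * (1 + c) := by
      refine le_of_mul_le_mul_left ?_ hη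
      nlinarith [mul_le_mul_of_nonneg_left hfc (sq_nonneg η)]
    linarith
  refine ⟨star g, fun f => ?_⟩
  obtain ⟨c, hc, hcf⟩ := RCLike.exists_norm_eq_mul_self (φ f - ∫ x, star g x * f x ∂ν)
  rcases eq_or_ne f 0 with rfl | hf
  · simp
  have hf0 : 0 < ‖f‖ := norm_pos_iff.2 hf
  have h := hunit ((((‖f‖⁻¹ : ℝ) : 𝕜) * c) • f) (by
    rw [norm_smul, norm_mul, hc, RCLike.norm_ofReal, abs_of_nonneg (by positivity), mul_one,
      inv_mul_cancel₀ hf0.ne'])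
  have e : φ ((((‖f‖⁻¹ : ℝ) : 𝕜) * c) • f)
      - ∫ x, star g x * ((((‖f‖⁻¹ : ℝ) : 𝕜) * c) • f) x ∂ν
      = ((‖f‖⁻¹ * ‖φ f - ∫ x, star g x * f x ∂ν‖ : ℝ) : 𝕜) := by
    rw [RCLike.ofReal_mul, hcf, map_smul]
    simp only [smul_apply, smul_eq_mul]
    rw [← mul_assoc, mul_sub, ← integral_const_mul]
    congr 2
    ext x
    ring
  rwa [e, RCLike.ofReal_re, inv_mul_le_iff₀ hf0, mul_comm] at h

end Density

end ZeroAtInftyContinuousMap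

/-! ### Partitions of unity with small oscillation -/

section Partition

variable {L : Type*} [TopologicalSpace L]

/-- Turn finitely many functions `s k`, at each point one of which is `1`, into a partition of unity
`χ` over a subset `T` of the indices, each member of which attains the value `1`. The ordered
products `s k * ∏ i < k, (1 - s i)` sum to `1`; their supports cover `L`, so a minimal subcover has
for each `k ∈ T` a point that lies in the `k`-th support only, and normalizing the sum over `T` gives
`χ`. -/
lemma exists_partition_attaining_one {ι : Type*} [Fintype ι] [LinearOrder ι] (s : ι → L → ℝ)
    (hc : ∀ k, Continuous (s k)) (h0 : ∀ k x, 0 ≤ s k x) (h1 : ∀ k x, s k x ≤ 1)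
    (hs : ∀ x, ∃ k, s k x = 1) :
    ∃ (T : Finset ι) (χ : ι → L → ℝ), (∀ k, Continuous (χ k)) ∧ (∀ k x, 0 ≤ χ k x) ∧
      (∀ x, ∑ k ∈ T, χ k x = 1) ∧ (∀ k ∈ T, ∃ x, χ k x = 1) ∧
      (∀ k x, χ k x ≠ 0 → s k x ≠ 0 ∧ ∀ i < k, s i x ≠ 1) ∧
      ∀ x, (∀ k, s k x = 0 ∨ s k x = 1) → ∀ k ∈ T, χ k x = 0 ∨ χ k x = 1 := by
  let φ : ι → L → ℝ := fun k x => s k x * ∏ i with i < k, (1 - s i x)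
  have hφc : ∀ k, Continuous (φ k) := fun k => by
    simp only [φ]; fun_prop
  have hφ0 : ∀ k x, 0 ≤ φ k x := fun k x =>
    mul_nonneg (h0 k x) (Finset.prod_nonneg fun i _ => sub_nonneg.2 (h1 i x))
  have hφ1 : ∀ x, ∑ k, φ k x = 1 := fun x => by
    have h := Finset.prod_one_sub_ordered Finset.univ (fun k => s k x)
    obtain ⟨k, hk⟩ := hs x
    rw [Finset.prod_eq_zero (Finset.mem_univ k) (by simp [hk])] at h
    simp only [φ]
    linarith
  obtain ⟨T, -, hT⟩ := (Set.toFinite {T : Finset ι | ∀ x, ∃ k ∈ T, φ k x ≠ 0}).exists_le_minimal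
    (a := Finset.univ) (fun x => by
      by_contra! h
      have := hφ1 x
      simp [Finset.sum_eq_zero fun k hk => h k hk] at this)
  have hS : ∀ x, 0 < ∑ k ∈ T, φ k x := fun x => by
    obtain ⟨k, hk, hkx⟩ := hT.prop x
    exact Finset.sum_pos' (fun i _ => hφ0 i x) ⟨k, hk, (hφ0 k x).lt_of_ne' hkx⟩
  refine ⟨T, fun k x => φ k x / ∑ i ∈ T, φ i x, fun k => ?_, fun k x => ?_, fun x => ?_,
    fun k hk => ?_, fun k x hx => ?_, fun x hx k hk => ?_⟩
  · exact (hφc k).div (by fun_prop) fun x => (hS x).ne'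
  · exact div_nonneg (hφ0 k x) (hS x).le
  · rw [← Finset.sum_div, div_self (hS x).ne']
  · have hne : ¬ ∀ x, ∃ i ∈ T.erase k, φ i x ≠ 0 := fun h =>
      Finset.notMem_erase k T (hT.le_of_le h (Finset.erase_subset k T) hk)
    push Not at hne
    obtain ⟨x, hx⟩ := hne
    refine ⟨x, ?_⟩
    have := hS x
    simp only
    rw [← Finset.add_sum_erase T _ hk, Finset.sum_eq_zero hx, add_zero] at this ⊢
    exact div_self this.ne'
  · have hφx : φ k x ≠ 0 := fun h => hx (by simp [h])
    refine ⟨left_ne_zero_of_mul hφx, fun i hi h => right_ne_zero_of_mul hφx ?_⟩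
    exact Finset.prod_eq_zero (i := i) (by simp [hi]) (by simp [h])
  · have hφk : φ k x = 0 ∨ φ k x = 1 := by
      by_cases h : ∃ i < k, s i x = 1
      · obtain ⟨i, hi, h⟩ := h
        left
        simp only [φ]
        rw [Finset.prod_eq_zero (i := i) (by simp [hi]) (by simp [h]), mul_zero]
      · push Not at h
        have : ∏ i with i < k, (1 - s i x) = 1 := Finset.prod_eq_one fun i hi => by
          simp [(hx i).resolve_right (h i (by simpa using hi))]
        simpa [φ, this] using hx k
    rcases hφk with h | h
    · left; simp [h]
    · right
      have e1 : φ k x ≤ ∑ i ∈ T, φ i x :=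
        Finset.single_le_sum (f := fun i => φ i x) (fun i _ => hφ0 i x) hk
      have e2 : ∑ i ∈ T, φ i x ≤ ∑ i, φ i x :=
        Finset.sum_le_univ_sum_of_nonneg fun i => hφ0 i x
      rw [hφ1] at e2
      rw [h] at e1
      simp only
      rw [h, le_antisymm e2 e1, div_one]

/-- A finite family of nonnegative functions in `C₀(L, ℝ)` with sum at most `1`, each of which attains
the value `1`. Where one of them is `1`, all others vanish, so the family spans an isometric copy of
`ℓ_∞^p`. -/
structure IsBumpFamily {p : ℕ} (χ : Fin p → C₀(L, ℝ)) : Prop where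
  nonneg : ∀ k x, 0 ≤ χ k x
  sum_le_one : ∀ x, ∑ k, χ k x ≤ 1
  exists_eq_one : ∀ k, ∃ x, χ k x = 1

lemma IsBumpFamily.eq_zero_of_eq_one {p : ℕ} {χ : Fin p → C₀(L, ℝ)} (h : IsBumpFamily χ)
    {k i : Fin p} (hik : i ≠ k) {x : L} (hx : χ k x = 1) : χ i x = 0 := by
  have h1 := h.sum_le_one x
  rw [← Finset.add_sum_erase _ _ (Finset.mem_univ k), hx] at h1
  have h2 := Finset.single_le_sum (f := fun i => χ i x) (fun i _ => h.nonneg i x)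
    (Finset.mem_erase.2 ⟨hik, Finset.mem_univ i⟩)
  exact le_antisymm (by linarith) (h.nonneg i x)

/-- A map `F` vanishing at infinity admits finitely many bump functions in `C₀(L, ℝ)`, each attaining
the value `1`, that form a partition of unity where `F` is not small, on whose supports `F`
oscillates little, and which take only the values `0` and `1` off a set of small `ν`-measure. -/
theorem exists_bumps [MeasurableSpace L] [BorelSpace L] (ν : Measure L) [IsFiniteMeasure ν]
    {E : Type*} [NormedAddCommGroup E] {F : L → E} (hF : Continuous F)
    (hF0 : Tendsto F (cocompact L) (𝓝 0)) {δ ε : ℝ} (hδ : 0 < δ) (hε : 0 < ε)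
    {b : L} (hb : 2 * δ < ‖F b‖) :
    ∃ (p : ℕ) (χ : Fin p → C₀(L, ℝ)), 0 < p ∧ IsBumpFamily χ ∧
      (∀ k x y, χ k x ≠ 0 → χ k y ≠ 0 → ‖F x - F y‖ ≤ 4 * δ) ∧
      (∀ x, 2 * δ < ‖F x‖ → ∑ k, χ k x = 1) ∧
      ν.real {x | ∃ k, χ k x ≠ 0 ∧ χ k x ≠ 1} ≤ ε := by
  have hsmall : ∀ᶠ x in cocompact L, ‖F x‖ < δ := by
    have := hF0.norm
    rw [norm_zero] at this
    exact this.eventually (gt_mem_nhds hδ)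
  -- Balls of radius `δ` around the centers `c k` cover the range of `F`; the first center is `0`.
  obtain ⟨n, c, hc0, hc⟩ : ∃ (n : ℕ) (c : Fin (n + 1) → E), c 0 = 0 ∧
      ∀ x, ∃ k, ‖F x - c k‖ ≤ δ := by
    obtain ⟨K, hK, hKδ⟩ := mem_cocompact.1 hsmall
    obtain ⟨t, -, ht⟩ := hK.elim_nhds_subcover (fun y => {x | ‖F x - F y‖ < δ}) fun y _ =>
      (isOpen_lt (by fun_prop) continuous_const).mem_nhds (by simpa using hδ)
    let e := t.equivFin
    refine ⟨t.card, Fin.cons 0 fun i => F (e.symm i), by simp, fun x => ?_⟩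
    by_cases hx : x ∈ K
    · obtain ⟨y, hy, hxy⟩ := Set.mem_iUnion₂.1 (ht hx)
      refine ⟨(e ⟨y, hy⟩).succ, ?_⟩
      simpa using (le_of_lt hxy)
    · exact ⟨0, by simpa using (le_of_lt (hKδ hx))⟩
  let d : Fin (n + 1) → L → ℝ := fun k x => ‖F x - c k‖
  have hd : ∀ k, Continuous (d k) := fun k => by simp only [d]; fun_prop
  -- The open annuli of radii `δ` and `δ + η` decrease to the empty set as `η` tends to `0`.
  obtain ⟨η, hη, hηδ, hηε⟩ : ∃ η : ℝ, 0 < η ∧ η ≤ δ ∧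
      ν.real {x | ∃ k, δ < d k x ∧ d k x < δ + η} ≤ ε := by
    let A : ℕ → Set L := fun m => {x | ∃ k, δ < d k x ∧ d k x < δ + δ / (m + 1)}
    have hA : ∀ m, MeasurableSet (A m) := fun m => by
      simp only [A, Set.ofPred_exists]
      exact (isOpen_iUnion fun k => (isOpen_lt continuous_const (hd k)).inter
        (isOpen_lt (hd k) continuous_const)).measurableSet
    have hanti : Antitone A := by
      rintro m m' h x ⟨k, h1, h2⟩
      refine ⟨k, h1, h2.trans_le ?_⟩
      have : (m : ℝ) ≤ m' := by exact_mod_cast h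
      gcongr
    have hemp : ⋂ m, A m = ∅ := by
      refine Set.eq_empty_of_forall_notMem fun x hx => ?_
      rw [Set.mem_iInter] at hx
      choose k hk using hx
      have hlim : ∀ i, ∀ᶠ m : ℕ in atTop, ¬ (δ < d i x ∧ d i x < δ + δ / (m + 1)) := by
        intro i
        by_cases hi : δ < d i x
        · have ht : Tendsto (fun m : ℕ => δ + δ / ((m : ℝ) + 1)) atTop (𝓝 (δ + 0)) := by
            refine tendsto_const_nhds.add ?_
            simpa [div_eq_mul_inv] using
              (tendsto_one_div_add_atTop_nhds_zero_nat (𝕜 := ℝ)).const_mul δ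
          rw [add_zero] at ht
          filter_upwards [ht.eventually (gt_mem_nhds hi)] with m hm h
          exact lt_asymm hm h.2
        · exact Eventually.of_forall fun m h => hi h.1
      obtain ⟨m, hm⟩ := (eventually_all.2 hlim).exists
      exact hm _ (hk m)
    have ht := tendsto_measure_iInter_atTop (μ := ν) (fun m => (hA m).nullMeasurableSet) hanti
      ⟨0, measure_ne_top _ _⟩
    rw [hemp, measure_empty] at ht
    obtain ⟨m, hm⟩ := (ht.eventually (gt_mem_nhds (ENNReal.ofReal_pos.2 hε))).exists
    refine ⟨δ / (m + 1), by positivity, div_le_self hδ.le (by simp), ?_⟩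
    exact ENNReal.toReal_le_of_le_ofReal hε.le hm.le
  let s : Fin (n + 1) → L → ℝ := fun k x => max 0 (min 1 (1 - (d k x - δ) / η))
  have s_one : ∀ k x, d k x ≤ δ → s k x = 1 := fun k x h => by
    have : (d k x - δ) / η ≤ 0 := div_nonpos_of_nonpos_of_nonneg (by linarith) hη.le
    simp only [s]
    rw [min_eq_left (by linarith), max_eq_right zero_le_one]
  have s_zero : ∀ k x, δ + η ≤ d k x → s k x = 0 := fun k x h => by
    have : 1 ≤ (d k x - δ) / η := (one_le_div hη).2 (by linarith)
    exact max_eq_left ((min_le_right _ _).trans (by linarith))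
  obtain ⟨T, χ, hχc, hχ0, hχ1, hχa, hχs, hχB⟩ := exists_partition_attaining_one s
    (fun k => by simp only [s]; fun_prop) (fun k x => le_max_left _ _)
    (fun k x => max_le zero_le_one (min_le_left _ _))
    (fun x => (hc x).imp fun k hk => s_one k x hk)
  -- Away from the first center the bumps vanish where `F` is small, hence near infinity.
  have hχz : ∀ k, k ≠ 0 → Tendsto (χ k) (cocompact L) (𝓝 0) := fun k hk => by
    refine tendsto_const_nhds.congr' (hsmall.mono fun x hx => ?_)
    by_contra h
    refine (hχs k x (Ne.symm h)).2 0 (Fin.pos_of_ne_zero hk) (s_one 0 x ?_)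
    simpa [d, hc0] using hx.le
  let e := (T.erase 0).equivFin
  let χ' : Fin (T.erase 0).card → C₀(L, ℝ) := fun k =>
    ⟨⟨χ (e.symm k), hχc _⟩, hχz _ (Finset.ne_of_mem_erase (e.symm k).2)⟩
  have hχ' : ∀ k x, χ' k x = χ (e.symm k) x := fun _ _ => rfl
  have hsum : ∀ x, ∑ k, χ' k x = ∑ k ∈ T.erase 0, χ k x := fun x => by
    simp only [hχ']
    rw [← Finset.sum_coe_sort (T.erase 0)]
    exact e.symm.sum_comp fun k : T.erase 0 => χ k x
  have hsum1 : ∀ x, 2 * δ < ‖F x‖ → ∑ k, χ' k x = 1 := fun x hx => by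
    rw [hsum, ← hχ1 x]
    refine Finset.sum_erase T ?_
    by_contra h
    exact (hχs 0 x h).1 (s_zero 0 x (by simp only [d, hc0, sub_zero]; linarith))
  refine ⟨_, χ', ?_, ⟨fun k x => hχ0 _ x, fun x => ?_, fun k => ?_⟩, fun k x y hx hy => ?_, hsum1,
    ?_⟩
  · by_contra h
    have := hsum1 b hb
    rw [hsum, Finset.card_eq_zero.1 (Nat.eq_zero_of_not_pos h)] at this
    simp at this
  · rw [hsum, ← hχ1 x]
    exact Finset.sum_le_sum_of_subset_of_nonneg (Finset.erase_subset _ _) fun i _ _ => hχ0 i x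
  · exact hχa _ (Finset.mem_of_mem_erase (e.symm k).2)
  · have near : ∀ z, χ' k z ≠ 0 → ‖F z - c (e.symm k)‖ ≤ 2 * δ := fun z hz => by
      by_contra! h
      exact (hχs _ z hz).1 (s_zero _ z (by simp only [d]; linarith))
    calc ‖F x - F y‖ = ‖(F x - c (e.symm k)) - (F y - c (e.symm k))‖ := by congr 1; abel
      _ ≤ _ := (norm_sub_le _ _).trans (add_le_add (near x hx) (near y hy))
      _ = 4 * δ := by ring
  · refine (measureReal_mono ?_ (measure_ne_top _ _)).trans hηε
    rintro x ⟨k, h1, h2⟩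
    by_contra h
    simp only [Set.mem_ofPred_eq, not_exists, not_and, not_lt] at h
    refine (hχB x (fun i => ?_) _ (Finset.mem_of_mem_erase (e.symm k).2)).elim h1 h2
    by_cases hi : δ < d i x
    · exact Or.inl (s_zero i x (h i hi))
    · exact Or.inr (s_one i x (not_lt.1 hi))

end Partition

/-! ### The averaging projection -/

section Projection

variable {𝕜 : Type*} [RCLike 𝕜]

/-- An isometric copy of `ℓ_∞^p` with a contractive left inverse is the range of a norm-one
projection. -/
lemma LinearIsometry.norm_one_projection {X : Type*} [NormedAddCommGroup X] [NormedSpace 𝕜 X] {p : ℕ}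
    (hp : 0 < p) (J : (Fin p → 𝕜) →ₗᵢ[𝕜] X) (A : X →L[𝕜] (Fin p → 𝕜)) (hA : ‖A‖ ≤ 1)
    (hAJ : ∀ c, A (J c) = c) {P : X →L[𝕜] X} (hP : ∀ f, P f = J (A f)) :
    P ∘L P = P ∧ ‖P‖ = 1 ∧ Nonempty (LinearMap.range (P : X →ₗ[𝕜] X) ≃ₗᵢ[𝕜] (Fin p → 𝕜)) := by
  have hPJ : ∀ c, P (J c) = J c := fun c => by rw [hP, hAJ]
  refine ⟨?_, le_antisymm ?_ ?_, ?_⟩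
  · ext1 f
    rw [ContinuousLinearMap.comp_apply, hP f, hPJ]
  · refine P.opNorm_le_bound zero_le_one fun f => ?_
    rw [hP, J.norm_map]
    exact A.le_of_opNorm_le hA f
  · let c : Fin p → 𝕜 := fun _ => 1
    have hc : J c ≠ 0 := fun h => by
      have := J.injective (h.trans J.map_zero.symm)
      simpa [c] using congrFun this ⟨0, hp⟩
    have := P.le_opNorm (J c)
    rw [hPJ] at this
    exact (le_mul_iff_one_le_left (norm_pos_iff.2 hc)).1 this
  · have hrange : LinearMap.range (P : X →ₗ[𝕜] X) = LinearMap.range J.toLinearMap := by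
      refine le_antisymm ?_ ?_
      · rintro _ ⟨f, rfl⟩
        exact ⟨A f, (hP f).symm⟩
      · rintro _ ⟨c, rfl⟩
        exact ⟨J c, hPJ c⟩
    rw [hrange]
    exact ⟨J.equivRange.symm⟩

/-- Averaging over a nonempty measurable set `K`; if `K` is a null set, a point mass will do. -/
lemma exists_isProbabilityMeasure_average {L : Type*} [MeasurableSpace L] (ν : Measure L) [IsFiniteMeasure ν]
    {K : Set L} (hK : MeasurableSet K) (hne : K.Nonempty) :
    ∃ π : Measure L, IsProbabilityMeasure π ∧ (∀ᵐ x ∂π, x ∈ K) ∧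
      ∀ f : L → 𝕜, ν.real K • ∫ x, f x ∂π = ∫ x in K, f x ∂ν := by
  by_cases h0 : ν K = 0
  · obtain ⟨t, ht⟩ := hne
    refine ⟨Measure.dirac t, inferInstance, ?_, fun f => ?_⟩
    · exact (ae_dirac_iff hK).2 ht
    · simp [Measure.real, h0, Measure.restrict_eq_zero.2 h0]
  · refine ⟨ProbabilityTheory.cond ν K, ProbabilityTheory.cond_isProbabilityMeasure h0,
      ProbabilityTheory.ae_cond_mem hK, fun f => ?_⟩
    rw [ProbabilityTheory.cond, integral_smul_measure, smul_smul, ENNReal.toReal_inv, Measure.real,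
      mul_inv_cancel₀ (ENNReal.toReal_ne_zero.2 ⟨h0, measure_ne_top _ _⟩), one_smul]

variable {L : Type*} [TopologicalSpace L]

namespace ZeroAtInftyContinuousMap

variable [MeasurableSpace L] [BorelSpace L] {p : ℕ}

/-- The averages of a function over probability measures `π k`, as a contraction to `ℓ_∞^p`. -/
noncomputable def averages (𝕜 : Type*) [RCLike 𝕜]
    (π : Fin p → Measure L) [∀ k, IsProbabilityMeasure (π k)] : C₀(L, 𝕜) →L[𝕜] (Fin p → 𝕜) :=
  LinearMap.mkContinuous
    { toFun := fun f k => ∫ x, f x ∂π k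
      map_add' := fun f g => by
        ext k
        exact integral_add (integrable (π k) f) (integrable (π k) g)
      map_smul' := fun a f => by
        ext k
        exact integral_const_mul a _ } 1 fun f => by
    rw [one_mul]
    refine (pi_norm_le_iff_of_nonneg (norm_nonneg _)).2 fun k => ?_
    simpa using norm_integral_le_of_norm_le_const (μ := π k)
      (Eventually.of_forall fun x => norm_apply_le f x)

variable (π : Fin p → Measure L) [∀ k, IsProbabilityMeasure (π k)]

lemma averages_apply (f : C₀(L, 𝕜)) (k : Fin p) :
    averages 𝕜 π f k = ∫ x, f x ∂π k := rfl

lemma norm_averages_le : ‖averages 𝕜 π‖ ≤ 1 :=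
  LinearMap.mkContinuous_norm_le _ zero_le_one _

end ZeroAtInftyContinuousMap

namespace IsBumpFamily

variable {p : ℕ} {χ : Fin p → C₀(L, ℝ)}

open ZeroAtInftyContinuousMap

lemma norm_sum_le (h : IsBumpFamily χ) {c : Fin p → 𝕜} {C : ℝ} (hC : 0 ≤ C) {x : L}
    (hc : ∀ k, χ k x ≠ 0 → ‖c k‖ ≤ C) : ‖∑ k, c k * (χ k x : 𝕜)‖ ≤ C := by
  calc ‖∑ k, c k * (χ k x : 𝕜)‖ ≤ ∑ k, C * χ k x := norm_sum_le_of_le _ fun k _ => by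
        rw [norm_mul, RCLike.norm_ofReal, abs_of_nonneg (h.nonneg k x)]
        by_cases hk : χ k x = 0
        · simp [hk]
        · exact mul_le_mul_of_nonneg_right (hc k hk) (h.nonneg k x)
    _ = C * ∑ k, χ k x := by rw [Finset.mul_sum]
    _ ≤ C := mul_le_of_le_one_right hC (h.sum_le_one x)

lemma sum_eq_of_eq_one (h : IsBumpFamily χ) (c : Fin p → 𝕜) {k : Fin p} {x : L} (hx : χ k x = 1) :
    ∑ i, c i * (χ i x : 𝕜) = c k := by
  rw [Finset.sum_eq_single k]
  · simp [hx]
  · intro i _ hik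
    simp [h.eq_zero_of_eq_one hik hx]
  · simp

/-- The isometric embedding of `ℓ_∞^p` into `C₀(L, 𝕜)` sending the basis vectors to the bumps. -/
noncomputable def embedding (𝕜 : Type*) [RCLike 𝕜] (h : IsBumpFamily χ) :
    (Fin p → 𝕜) →ₗᵢ[𝕜] C₀(L, 𝕜) where
  toFun c := ⟨⟨fun x => ∑ k, c k * (χ k x : 𝕜), by fun_prop⟩, by
    have : ∀ k, Tendsto (fun x => c k * (χ k x : 𝕜)) (cocompact L) (𝓝 0) := fun k => by
      simpa using ((RCLike.continuous_ofReal (K := 𝕜)).tendsto 0).comp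
        (zero_at_infty (χ k)) |>.const_mul (c k)
    simpa using tendsto_finsetSum Finset.univ fun k _ => this k⟩
  map_add' c d := by
    ext x
    simp [add_mul, Finset.sum_add_distrib]
  map_smul' a c := by
    ext x
    simp [mul_assoc, Finset.mul_sum]
  norm_map' c := by
    refine le_antisymm (norm_le_of_forall (norm_nonneg _) fun x => ?_) ?_
    · exact h.norm_sum_le (norm_nonneg c) fun k _ => norm_le_pi_norm c k
    · refine (pi_norm_le_iff_of_nonneg (norm_nonneg _)).2 fun k => ?_
      obtain ⟨x, hx⟩ := h.exists_eq_one k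
      rw [← h.sum_eq_of_eq_one c hx]
      exact norm_apply_le (L := L) ⟨⟨fun x => ∑ k, c k * (χ k x : 𝕜), _⟩, _⟩ x

lemma embedding_apply (h : IsBumpFamily χ) (c : Fin p → 𝕜) (x : L) :
    h.embedding 𝕜 c x = ∑ k, c k * (χ k x : 𝕜) := rfl

variable [MeasurableSpace L] [BorelSpace L]

variable (π : Fin p → Measure L) [∀ k, IsProbabilityMeasure (π k)]

/-- The operator that replaces `f` by the combination of the bumps `χ k` whose coefficients are the
averages of `f` over `π k`. -/
noncomputable def projection (𝕜 : Type*) [RCLike 𝕜] (h : IsBumpFamily χ) (π : Fin p → Measure L)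
    [∀ k, IsProbabilityMeasure (π k)] : C₀(L, 𝕜) →L[𝕜] C₀(L, 𝕜) :=
  (h.embedding 𝕜).toContinuousLinearMap ∘L averages 𝕜 π

lemma projection_apply (h : IsBumpFamily χ) (f : C₀(L, 𝕜)) (x : L) :
    h.projection 𝕜 π f x = ∑ k, (∫ y, f y ∂π k) * (χ k x : 𝕜) := rfl

variable {π}

lemma averages_embedding (h : IsBumpFamily χ) (hπ : ∀ k, ∀ᵐ x ∂π k, χ k x = 1) (c : Fin p → 𝕜) :
    averages 𝕜 π (h.embedding 𝕜 c) = c := by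
  ext k
  rw [averages_apply, integral_congr_ae (g := fun _ => c k)]
  · simp
  · filter_upwards [hπ k] with x hx
    rw [embedding_apply, h.sum_eq_of_eq_one c hx]

/-- `ω` bounds the oscillation of `g` on the support of each bump, and the size of `g` where the bumps
do not sum to `1`. -/
def IsAdapted (χ : Fin p → C₀(L, ℝ)) (g : C₀(L, 𝕜)) (ω : ℝ) : Prop :=
  (∀ k x y, χ k x ≠ 0 → χ k y ≠ 0 → ‖g x - g y‖ ≤ ω) ∧ ∀ x, ∑ k, χ k x ≠ 1 → ‖g x‖ ≤ ω

lemma norm_projection_sub_le (h : IsBumpFamily χ) (hπ : ∀ k, ∀ᵐ x ∂π k, χ k x = 1) {g : C₀(L, 𝕜)}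
    {ω : ℝ} (hω : 0 ≤ ω) (hg : IsAdapted χ g ω) : ‖h.projection 𝕜 π g - g‖ ≤ 2 * ω := by
  refine norm_le_of_forall (by positivity) fun x => ?_
  have e : (h.projection 𝕜 π g - g) x
      = ∑ k, ((∫ y, g y ∂π k) - g x) * (χ k x : 𝕜) + g x * ((∑ k, χ k x - 1 : ℝ) : 𝕜) := by
    rw [ZeroAtInftyContinuousMap.sub_apply, projection_apply]
    push_cast
    simp only [sub_mul, Finset.sum_sub_distrib, ← Finset.mul_sum]
    ring
  have h1 : ‖∑ k, ((∫ y, g y ∂π k) - g x) * (χ k x : 𝕜)‖ ≤ ω := by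
    refine h.norm_sum_le hω fun k hk => ?_
    have e' : (∫ y, g y ∂π k) - g x = ∫ y, (g y - g x) ∂π k := by
      rw [integral_sub (integrable _ g) (integrable_const _)]
      simp
    rw [e']
    have := norm_integral_le_of_norm_le_const (μ := π k) (f := fun y => g y - g x) (C := ω) (by
      filter_upwards [hπ k] with y hy
      exact hg.1 k y x (by simp [hy]) hk)
    simpa using this
  have h2 : ‖g x * ((∑ k, χ k x - 1 : ℝ) : 𝕜)‖ ≤ ω := by
    by_cases hx : ∑ k, χ k x = 1
    · simpa [hx] using hω
    · rw [norm_mul, RCLike.norm_ofReal]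
      refine (mul_le_of_le_one_right (norm_nonneg _) ?_).trans (hg.2 x hx)
      have := h.sum_le_one x
      have : 0 ≤ ∑ k, χ k x := Finset.sum_nonneg fun k _ => h.nonneg k x
      exact abs_le.2 ⟨by linarith, by linarith⟩
  rw [e]
  exact (norm_add_le _ _).trans (by linarith)

/-- If `π k` averages `ν` over `{χ k = 1}`, then `f` and its image under the projection have the same
`ν`-integral over each `{χ k = 1}`, so in `∫ g * (P f - f) ∂ν` the density `g` may be corrected by a
function constant on these sets. For adapted `g` the difference is small off the set of points where
some bump is neither `0` nor `1`. -/
lemma norm_integral_mul_projection_sub_le (h : IsBumpFamily χ) (ν : Measure L) [IsFiniteMeasure ν]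
    (hν : ∀ k, ∀ f : C₀(L, 𝕜), ν.real {x | χ k x = 1} • ∫ x, f x ∂π k = ∫ x in {x | χ k x = 1}, f x ∂ν)
    {g : C₀(L, 𝕜)} {ω : ℝ} (hω : 0 ≤ ω) (hg : IsAdapted χ g ω) (f : C₀(L, 𝕜))
    (hf : ‖h.projection 𝕜 π f‖ ≤ ‖f‖) :
    ‖∫ x, g x * (h.projection 𝕜 π f - f) x ∂ν‖ ≤
      (2 * (ω * ν.real Set.univ + 2 * ‖g‖ * ν.real {x | ∃ k, χ k x ≠ 0 ∧ χ k x ≠ 1})) * ‖f‖ := by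
  set B : Set L := {x | ∃ k, χ k x ≠ 0 ∧ χ k x ≠ 1} with hB
  set q := h.projection 𝕜 π f - f with hq
  have hK : ∀ k, MeasurableSet {x | χ k x = 1} := fun k =>
    (isClosed_eq (χ k).continuous continuous_const).measurableSet
  have hBm : MeasurableSet B := by
    rw [hB, Set.ofPred_exists]
    exact (isOpen_iUnion fun k => ((isClosed_eq (χ k).continuous continuous_const).isOpen_compl.inter
      (isClosed_eq (χ k).continuous continuous_const).isOpen_compl)).measurableSet
  choose t ht using h.exists_eq_one
  let G : L → 𝕜 := fun x => ∑ k, ({x | χ k x = 1} : Set L).indicator (fun _ => g (t k)) x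
  have hG1 : ∀ k x, χ k x = 1 → G x = g (t k) := fun k x hx => by
    simp only [G]
    rw [Finset.sum_eq_single k]
    · simp [hx]
    · intro i _ hik
      simp [h.eq_zero_of_eq_one hik hx]
    · simp
  have hG0 : ∀ x, (∀ k, χ k x ≠ 1) → G x = 0 := fun x hx => by simp [G, hx]
  have hGint : Integrable (fun x => G x * q x) ν ∧ ∫ x, G x * q x ∂ν = 0 := by
    have e : (fun x => G x * q x) = fun x => ∑ k, ({x | χ k x = 1} : Set L).indicator
        (fun x => g (t k) * q x) x := by
      ext x
      simp only [G, Finset.sum_mul]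
      refine Finset.sum_congr rfl fun k _ => ?_
      by_cases hx : χ k x = 1 <;> simp [hx]
    have hi : ∀ k, Integrable (({x | χ k x = 1} : Set L).indicator (fun x => g (t k) * q x)) ν :=
      fun k => ((integrable ν q).const_mul _).indicator (hK k)
    rw [e]
    refine ⟨integrable_finsetSum _ fun k _ => hi k, ?_⟩
    rw [integral_finsetSum _ fun k _ => hi k]
    refine Finset.sum_eq_zero fun k _ => ?_
    have hzero : ∫ x in {x | χ k x = 1}, q x ∂ν = 0 := by
      have e' : ∫ x in {x | χ k x = 1}, q x ∂ν
          = ∫ x in {x | χ k x = 1}, ((∫ y, f y ∂π k) - f x) ∂ν := by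
        refine setIntegral_congr_fun (hK k) fun x hx => ?_
        simp only [hq, ZeroAtInftyContinuousMap.sub_apply, projection_apply]
        rw [h.sum_eq_of_eq_one (fun k => ∫ y, f y ∂π k) hx]
      rw [e', integral_sub (integrable_const _) (integrable ν f).integrableOn, ← hν k f]
      simp
    rw [integral_indicator (hK k), integral_const_mul, hzero, mul_zero]
  have hqx : ∀ x, ‖q x‖ ≤ 2 * ‖f‖ := fun x =>
    (norm_apply_le q x).trans ((norm_sub_le _ _).trans (by linarith))
  have hGx : ∀ x, ‖G x‖ ≤ ‖g‖ := fun x => by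
    by_cases hx : ∃ k, χ k x = 1
    · obtain ⟨k, hk⟩ := hx
      rw [hG1 k x hk]
      exact norm_apply_le g _
    · rw [hG0 x (not_exists.1 hx), norm_zero]
      exact norm_nonneg g
  have hdiff : ∀ x, ‖g x - G x‖ ≤ ω + B.indicator (fun _ => 2 * ‖g‖) x := fun x => by
    by_cases hxB : x ∈ B
    · rw [Set.indicator_of_mem hxB]
      have := norm_sub_le (g x) (G x)
      linarith [norm_apply_le g x, hGx x]
    rw [Set.indicator_of_notMem hxB, add_zero]
    by_cases hx : ∃ k, χ k x = 1
    · obtain ⟨k, hk⟩ := hx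
      rw [hG1 k x hk]
      exact hg.1 k x (t k) (by simp [hk]) (by simp [ht])
    · rw [hG0 x (not_exists.1 hx), sub_zero]
      refine hg.2 x ?_
      have : ∀ k, χ k x = 0 := fun k => by
        by_contra h0
        exact hxB ⟨k, h0, not_exists.1 hx k⟩
      simp [this]
  have e : ∫ x, g x * q x ∂ν = ∫ x, (g x - G x) * q x ∂ν := by
    simp only [sub_mul]
    rw [integral_sub (integrable_mul ν q g) hGint.1, hGint.2, sub_zero]
  have hb : Integrable (fun x => (ω + B.indicator (fun _ => 2 * ‖g‖) x) * (2 * ‖f‖)) ν :=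
    ((integrable_const ω).add ((integrable_const _).indicator hBm)).mul_const _
  rw [e]
  calc ‖∫ x, (g x - G x) * q x ∂ν‖
      ≤ ∫ x, (ω + B.indicator (fun _ => 2 * ‖g‖) x) * (2 * ‖f‖) ∂ν := by
        refine norm_integral_le_of_norm_le hb (Eventually.of_forall fun x => ?_)
        rw [norm_mul]
        exact mul_le_mul (hdiff x) (hqx x) (norm_nonneg _) ((norm_nonneg _).trans (hdiff x))
    _ = _ := by
        rw [integral_mul_const, integral_add (integrable_const _)
          ((integrable_const _).indicator hBm), integral_indicator hBm]
        simp
        ring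

end IsBumpFamily

end Projection

/-! ### Approximating by averaging projections -/

open ZeroAtInftyContinuousMap

/-- `C₀(L, 𝕜)` carries the sup norm, `μ j ∘L P` is the value at `μ j` of the adjoint of `P`, and
`Fin p → 𝕜` with its sup norm is the `p`-dimensional `ℓ_∞` space. -/
theorem theorem3p4 {𝕜 : Type*} [RCLike 𝕜] {L : Type*} [TopologicalSpace L] [T2Space L]
    [LocallyCompactSpace L] [Nonempty L] {l n : ℕ}
    (f : Fin l → C₀(L, 𝕜)) (hf : ∀ j, ‖f j‖ ≤ 1)
    (μ : Fin n → StrongDual 𝕜 C₀(L, 𝕜)) (hμ : ∀ j, ‖μ j‖ ≤ 1)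
    (ε : ℝ) (hε : 0 < ε) :
    ∃ P : C₀(L, 𝕜) →L[𝕜] C₀(L, 𝕜),
      P ∘L P = P ∧ ‖P‖ = 1 ∧
      (∀ j, ‖μ j ∘L P - μ j‖ < ε) ∧
      (∀ j, ‖P (f j) - f j‖ < ε) ∧
      ∃ p : ℕ, 0 < p ∧
        Nonempty (LinearMap.range (P : C₀(L, 𝕜) →ₗ[𝕜] C₀(L, 𝕜)) ≃ₗᵢ[𝕜] (Fin p → 𝕜)) := by
  borelize L
  obtain ⟨ν, hν, hμν⟩ := exists_measure_forall_norm_le μ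
  choose g hg using fun j => exists_density ν (μ j) (hμν j) (δ := ε / 8) (by positivity)
  obtain ⟨b⟩ := ‹Nonempty L›
  obtain ⟨u, hub, -, huc, hu⟩ := exists_continuous_one_zero_of_isCompact (isCompact_singleton (x := b))
    isClosed_empty (Set.disjoint_empty _)
  -- The bump function `u` guarantees that `F` is not small everywhere.
  let F : L → (Fin l → 𝕜) × (Fin n → 𝕜) × ℝ := fun x => (fun j => f j x, fun j => g j x, u x)
  have hF : Continuous F := by fun_prop
  have hF0 : Tendsto F (cocompact L) (𝓝 0) := by
    refine Tendsto.prodMk_nhds (tendsto_pi_nhds.2 fun j => zero_at_infty (f j))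
      (Tendsto.prodMk_nhds (tendsto_pi_nhds.2 fun j => zero_at_infty (g j)) ?_)
    exact huc.is_zero_at_infty
  have hFb : 1 ≤ ‖F b‖ := by
    have : ‖u b‖ ≤ ‖F b‖ := (norm_snd_le (F b).2).trans (norm_snd_le (F b))
    simpa [hub rfl] using this
  set c := ν.real Set.univ with hc
  have hc0 : 0 ≤ c := measureReal_nonneg
  set D := ∑ j, ‖g j‖ with hD
  have hD0 : 0 ≤ D := by positivity
  have hgD : ∀ j, ‖g j‖ ≤ D := fun j =>
    Finset.single_le_sum (f := fun j => ‖g j‖) (fun i _ => norm_nonneg _) (Finset.mem_univ j)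
  obtain ⟨ω, hω, hω1, hωε, hωc⟩ : ∃ ω : ℝ, 0 < ω ∧ ω ≤ 1 ∧ 2 * ω < ε ∧ 2 * (ω * c) ≤ ε / 4 := by
    refine ⟨min 1 (min (ε / 4) (ε / (8 * (c + 1)))), by positivity, min_le_left _ _, ?_, ?_⟩
    · have := (min_le_right 1 (min (ε / 4) (ε / (8 * (c + 1))))).trans (min_le_left _ _)
      linarith
    · have h1 := (min_le_right 1 (min (ε / 4) (ε / (8 * (c + 1))))).trans (min_le_right _ _)
      rw [le_div_iff₀ (by positivity)] at h1
      nlinarith [show 0 < min 1 (min (ε / 4) (ε / (8 * (c + 1)))) by positivity]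
  obtain ⟨η, hη, hηε⟩ : ∃ η : ℝ, 0 < η ∧ 2 * (2 * D * η) ≤ ε / 4 := by
    refine ⟨ε / (16 * (D + 1)), by positivity, ?_⟩
    rw [mul_div_assoc', mul_div_assoc', div_le_iff₀ (by positivity)]
    nlinarith
  obtain ⟨p, χ, hp, hχ, hosc, hsum, hbad⟩ := exists_bumps ν hF hF0 (δ := ω / 4) (by positivity) hη
    (b := b) (by linarith)
  have hadapt : ∀ h : C₀(L, 𝕜), (∀ x, ‖h x‖ ≤ ‖F x‖) → (∀ x y, ‖h x - h y‖ ≤ ‖F x - F y‖) →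
      IsBumpFamily.IsAdapted χ h ω := fun h h1 h2 => by
    refine ⟨fun k x y hx hy => (h2 x y).trans ((hosc k x y hx hy).trans (by linarith)),
      fun x hx => (h1 x).trans ?_⟩
    have : ‖F x‖ ≤ 2 * (ω / 4) := not_lt.1 fun h => hx (hsum x h)
    linarith
  have hfad : ∀ j, IsBumpFamily.IsAdapted χ (f j) ω := fun j => hadapt _
    (fun x => (norm_le_pi_norm (F x).1 j).trans (norm_fst_le _))
    (fun x y => (norm_le_pi_norm (F x - F y).1 j).trans (norm_fst_le _))
  have hgad : ∀ j, IsBumpFamily.IsAdapted χ (g j) ω := fun j => hadapt _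
    (fun x => (norm_le_pi_norm (F x).2.1 j).trans ((norm_fst_le _).trans (norm_snd_le _)))
    (fun x y => (norm_le_pi_norm (F x - F y).2.1 j).trans ((norm_fst_le _).trans (norm_snd_le _)))
  choose π hπ hπK hπν using fun k => exists_isProbabilityMeasure_average (𝕜 := 𝕜) ν
    (isClosed_eq (χ k).continuous continuous_const).measurableSet (hχ.exists_eq_one k)
  set P := hχ.projection 𝕜 π with hPdef
  obtain ⟨hPP, hP1, hPr⟩ := LinearIsometry.norm_one_projection hp (hχ.embedding 𝕜) (averages 𝕜 π)
    (norm_averages_le π) (hχ.averages_embedding hπK) (P := P) fun _ => rfl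
  refine ⟨P, hPP, hP1, fun j => ?_, fun j => ?_, p, hp, hPr⟩
  · have hbound : ∀ h : C₀(L, 𝕜), ‖(μ j ∘L P - μ j) h‖ ≤ (3 / 4 * ε) * ‖h‖ := fun h => by
      have hPh : ‖P h‖ ≤ ‖h‖ := by simpa [hP1] using P.le_opNorm h
      have h1 := hg j (P h - h)
      have h2 := hχ.norm_integral_mul_projection_sub_le ν (fun k f => hπν k f) hω.le (hgad j) h hPh
      have h3 : ‖P h - h‖ ≤ 2 * ‖h‖ := (norm_sub_le _ _).trans (by linarith)
      have e : (μ j ∘L P - μ j) h = (μ j (P h - h) - ∫ x, g j x * (P h - h) x ∂ν)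
          + ∫ x, g j x * (P h - h) x ∂ν := by
        simp
      have h4 : 2 * (ω * c + 2 * ‖g j‖ * ν.real {x | ∃ k, χ k x ≠ 0 ∧ χ k x ≠ 1}) ≤ ε / 2 := by
        have : 2 * ‖g j‖ * ν.real {x | ∃ k, χ k x ≠ 0 ∧ χ k x ≠ 1} ≤ 2 * D * η := by
          have := hgD j
          gcongr
        linarith
      rw [e]
      refine (norm_add_le _ _).trans ?_
      have h5 := h2.trans (mul_le_mul_of_nonneg_right h4 (norm_nonneg h))
      have h6 := h1.trans (mul_le_mul_of_nonneg_left h3 (by positivity))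
      linarith
    exact (ContinuousLinearMap.opNorm_le_bound _ (by positivity) hbound).trans_lt (by linarith)
  · exact (hχ.norm_projection_sub_le hπK hω.le (hfad j)).trans_lt hωε
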